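/- For a complex $m\times n$ matrix $X$ let $B_X(a,b)=\sum_{i,j}a_iX_{ij}b_j$ be the bilinear form with kernel $X$ on the product of the abelian C*-algebras $(\mathbb C^m,\|\cdot\|_\infty)$ and $(\mathbb C^n,\|\cdot\|_\infty)$. Let $\|X\|_B=\sup\{|B_X(a,b)|:\|a\|_\infty\le1,\ \|b\|_\infty\le1\}$ be its norm, and let $\|X\|_{cbB}=\sup_{k\in\mathbb N}\|(B_X)_k\|$ be its completely bounded norm, where the amplification $(B_X)_k:M_k(\mathbb C^m)\times M_k(\mathbb C^n)\to M_k(\mathbb C)$ is $(B_X)_k(a,b)_{pq}=\sum_{r=1}^kB_X(a_{pr},b_{rq})$, the matrix algebras carry their C*-norms, and $\|(B_X)_k\|$ is the supremum of $\|(B_X)_k(a,b)\|$ over $\|a\|\le1$, $\|b\|\le1$. Put $k_G^{\mathbb C}=4/\pi$. (i) If $X$ is a positive (semidefinite) complex $n\times n$ matrix, then $\|X\|_{cbB}\le k_G^{\mathbb C}\,\|X\|_B$. (ii) For every complex $m\times n$ matrix $X$, $\displaystyle \|X\|_{cbB}\le\frac{k_G^{\mathbb C}}{2-k_G^{\mathbb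 C}}\,\|X\|_B$. (iii) Consequently there is a least positive real number $K_G^{\mathbb C}$ such that $\|X\|_{cbB}\le K_G^{\mathbb C}\|X\|_B$ for all $m,n$ and all complex $m\times n$ matrices $X$ (Grothendieck's big inequality), and $\displaystyle K_G^{\mathbb C}\le\frac{k_G^{\mathbb C}}{2-k_G^{\mathbb C}}<1.752$. -/

import Mathlib

open scoped ComplexOrder ENNReal

noncomputable section

/-- The bilinear form `B_X (a, b) = ∑ i, ∑ j, a i * X i j * b j` with kernel the complex
`m × n` matrix `X`, on the product of the abelian C*-algebras `ℂᵐ` and `ℂⁿ`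
(`Fin m → ℂ` carries the supremum norm and pointwise operations). -/
def matrixForm {m n : ℕ} (X : Matrix (Fin m) (Fin n) ℂ) :
    (Fin m → ℂ) →L[ℂ] (Fin n → ℂ) →L[ℂ] ℂ :=
  (Matrix.toLinearMap₂' ℂ X).toContinuousBilinearMap

theorem matrixForm_apply {m n : ℕ} (X : Matrix (Fin m) (Fin n) ℂ)
    (a : Fin m → ℂ) (b : Fin n → ℂ) :
    matrixForm X a b = ∑ i, ∑ j, a i * X i j * b j := by
  simp [matrixForm, LinearMap.toContinuousBilinearMap_apply, Matrix.toLinearMap₂'_apply,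
    mul_comm, mul_left_comm]

/-- The norm `‖X‖_B` of the bilinear form `B_X`, i.e. the least `C ≥ 0` with
`|B_X (a, b)| ≤ C ‖a‖_∞ ‖b‖_∞` for all `a`, `b`. -/
def normB {m n : ℕ} (X : Matrix (Fin m) (Fin n) ℂ) : ℝ := ‖matrixForm X‖

section CompletelyBounded

variable {A B : Type*} [CStarAlgebra A] [CStarAlgebra B]

/-- The `k`-th amplification `M_k(A) × M_k(B) → M_k(ℂ)` of a bilinear form `φ` on `A × B`,
`φ_k (a, b) p q = ∑ r, φ (a p r, b r q)` (Christensen and Sinclair). -/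
def amplification (φ : A →L[ℂ] B →L[ℂ] ℂ) (k : ℕ)
    (a : CStarMatrix (Fin k) (Fin k) A) (b : CStarMatrix (Fin k) (Fin k) B) :
    CStarMatrix (Fin k) (Fin k) ℂ :=
  CStarMatrix.ofMatrix (Matrix.of fun p q => ∑ r, φ (a p r) (b r q))

/-- The completely bounded norm of a bilinear form on a product of C*-algebras: the supremum of the
norms of all its amplifications, where the matrix algebras carry their C*-norms. It takes the value
`∞` when the amplifications are not uniformly bounded. -/
def cbNorm [PartialOrder A] [StarOrderedRing A] [PartialOrder B] [StarOrderedRing B]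
    (φ : A →L[ℂ] B →L[ℂ] ℂ) : ℝ≥0∞ :=
  ⨆ (k : ℕ) (a : CStarMatrix (Fin k) (Fin k) A) (b : CStarMatrix (Fin k) (Fin k) B)
    (_ : ‖a‖ ≤ 1) (_ : ‖b‖ ≤ 1), ENNReal.ofReal ‖amplification φ k a b‖

end CompletelyBounded

/-- The completely bounded norm `‖X‖_cbB` of the bilinear form with kernel `X`. -/
def normCbB {m n : ℕ} (X : Matrix (Fin m) (Fin n) ℂ) : ℝ≥0∞ := cbNorm (matrixForm X)

/-- The positive constants `K` for which Grothendieck's (big, complex) inequality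
`‖X‖_cbB ≤ K ‖X‖_B` holds for all complex matrices of all sizes. -/
def bigGrothendieckBounds : Set ℝ :=
  {K | 0 < K ∧ ∀ (m n : ℕ) (X : Matrix (Fin m) (Fin n) ℂ),
    normCbB X ≤ ENNReal.ofReal (K * normB X)}

/-- The complex Grothendieck constant, the infimum of the admissible constants. -/
def complexGrothendieckConst : ℝ := sInf bigGrothendieckBounds

end

open MeasureTheory
open scoped ComplexConjugate

/-! The argument bounds `∑ X i j * ⟪u i, v j⟫` over vectors in Hilbert unit balls. Such a bound
controls `‖X‖_cbB`: an amplification is `∑ X i j • (A i * B j)` with contractions `A i`, `B j`, and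
pairing it with unit vectors `x`, `y` gives the vectors `(A i)* y` and `B j x`
(`norm_amplification_le`).

Attach to `u` the Gaussian field `g_u` and its phase `s_u = ‖u‖ g_u / |g_u|`. Then `E[conj g_u *
g_v] = ⟪u, v⟫` and `E[conj s_u * g_v] = (√π / 2) ⟪u, v⟫`, so the residuals `r_u = s_u - (√π / 2)
g_u` satisfy `⟪r_u, r_v⟫ = E[conj s_u * s_v] - (π / 4) ⟪u, v⟫` (`inner_phaseResidual`). Since `|s_u|
≤ ‖u‖`, the phase term contributes at most `‖X‖_B`.

For positive `X` the form is nonnegative at the residuals, which gives `4 / π` on the diagonal;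
polarization does the rest. For general `X`, let `C` be the least Hilbert bound. As `‖r_u‖² ≤ 1 - π
/ 4`, it obeys `(π / 4) C ≤ ‖X‖_B + (1 - π / 4) C`, which is solved for `C`. -/

/-! ### The standard complex Gaussian measure: moments and unitary invariance. -/

/-- The density of the standard complex Gaussian measure on `ℂⁿ`. -/
noncomputable def complexGaussianDensity (N : ℕ) (x : Fin N → ℂ) : ℝ :=
  ∏ k, (Real.pi⁻¹ * Real.exp (-‖x k‖ ^ 2))

/-- The standard complex Gaussian measure on `ℂⁿ`. -/
noncomputable def complexGaussian (N : ℕ) : Measure (Fin N → ℂ) :=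
  volume.withDensity fun x => ENNReal.ofReal (complexGaussianDensity N x)

lemma complexGaussianDensity_nonneg (N : ℕ) (x : Fin N → ℂ) : 0 ≤ complexGaussianDensity N x :=
  Finset.prod_nonneg fun _ _ => by positivity

lemma continuous_complexGaussianDensity (N : ℕ) : Continuous (complexGaussianDensity N) := by
  unfold complexGaussianDensity
  fun_prop

lemma integral_prod_complexGaussian {N : ℕ} (h : Fin N → ℂ → ℂ) :
    ∫ x, ∏ k, h k (x k) ∂complexGaussian N =
      ∏ k, ∫ z, (Real.pi⁻¹ * Real.exp (-‖z‖ ^ 2) : ℝ) • h k z := by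
  rw [complexGaussian, integral_withDensity_eq_integral_toReal_smul
    (continuous_complexGaussianDensity N).measurable.ennreal_ofReal
    (ae_of_all _ fun _ => ENNReal.ofReal_lt_top), ← integral_fintype_prod_volume_eq_prod]
  refine integral_congr_ae (ae_of_all _ fun x => ?_)
  dsimp only
  rw [ENNReal.toReal_ofReal (complexGaussianDensity_nonneg N x), complexGaussianDensity]
  simp only [Complex.real_smul, Finset.prod_mul_distrib, Complex.ofReal_prod, Complex.ofReal_mul]

lemma integrable_prod_complexGaussian {N : ℕ} (h : Fin N → ℂ → ℂ)
    (hh : ∀ k, Integrable fun z => (Real.pi⁻¹ * Real.exp (-‖z‖ ^ 2) : ℝ) • h k z) :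
    Integrable (fun x => ∏ k, h k (x k)) (complexGaussian N) := by
  rw [complexGaussian, integrable_withDensity_iff_integrable_smul'
    (continuous_complexGaussianDensity N).measurable.ennreal_ofReal
    (ae_of_all _ fun _ => ENNReal.ofReal_lt_top)]
  refine (Integrable.fintype_prod hh).congr (ae_of_all _ fun x => ?_)
  dsimp only
  rw [ENNReal.toReal_ofReal (complexGaussianDensity_nonneg N x), complexGaussianDensity]
  simp only [Complex.real_smul, Finset.prod_mul_distrib, Complex.ofReal_prod, Complex.ofReal_mul]

lemma integral_norm_pow_mul_exp (n : ℕ) :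
    ∫ z : ℂ, Real.pi⁻¹ * Real.exp (-‖z‖ ^ 2) * ‖z‖ ^ n = Real.Gamma (n / 2 + 1) := by
  have h := Complex.integral_rpow_mul_exp_neg_rpow (p := 2) (q := n) (by norm_num)
    (by have := n.cast_nonneg (α := ℝ); linarith)
  have e : (fun z : ℂ => Real.pi⁻¹ * Real.exp (-‖z‖ ^ 2) * ‖z‖ ^ n) =
      fun z => Real.pi⁻¹ * (‖z‖ ^ (n : ℝ) * Real.exp (-‖z‖ ^ (2 : ℝ))) := by
    ext z
    rw [Real.rpow_natCast, Real.rpow_two]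
    ring
  rw [e, integral_const_mul, h, show ((n : ℝ) + 2) / 2 = n / 2 + 1 by ring]
  field_simp

lemma integrable_norm_pow_mul_exp (n : ℕ) :
    Integrable fun z : ℂ => Real.pi⁻¹ * Real.exp (-‖z‖ ^ 2) * ‖z‖ ^ n := by
  -- A non-integrable function has Bochner integral zero, but the integral is a positive Gamma
  -- value.
  by_contra hc
  have h := integral_norm_pow_mul_exp n
  rw [integral_undef hc] at h
  exact absurd h (Real.Gamma_pos_of_pos (by positivity)).ne

lemma integrable_gaussian_smul_of_norm_le {h : ℂ → ℂ} (hm : Measurable h) (n : ℕ)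
    (hb : ∀ z, ‖h z‖ ≤ ‖z‖ ^ n) :
    Integrable fun z : ℂ => (Real.pi⁻¹ * Real.exp (-‖z‖ ^ 2) : ℝ) • h z := by
  refine (integrable_norm_pow_mul_exp n).mono' (by fun_prop) (ae_of_all _ fun z => ?_)
  rw [norm_smul, Real.norm_of_nonneg (by positivity)]
  gcongr
  exact hb z

/-- An odd function integrates to zero against the Gaussian density. -/
lemma integral_gaussian_smul_of_odd {h : ℂ → ℂ} (ho : ∀ z, h (-z) = -h z) :
    ∫ z : ℂ, (Real.pi⁻¹ * Real.exp (-‖z‖ ^ 2) : ℝ) • h z = 0 := by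
  have := integral_neg_eq_self (fun z : ℂ => (Real.pi⁻¹ * Real.exp (-‖z‖ ^ 2) : ℝ) • h z) volume
  simp only [norm_neg, ho, smul_neg, integral_neg] at this
  exact self_eq_neg.mp this.symm

lemma integral_gaussian_smul_norm_pow (n : ℕ) :
    ∫ z : ℂ, (Real.pi⁻¹ * Real.exp (-‖z‖ ^ 2) : ℝ) • ((‖z‖ ^ n : ℝ) : ℂ) =
      Real.Gamma (n / 2 + 1) := by
  rw [← integral_norm_pow_mul_exp, ← integral_complex_ofReal]
  simp

lemma integral_gaussian_smul_one :
    ∫ z : ℂ, (Real.pi⁻¹ * Real.exp (-‖z‖ ^ 2) : ℝ) • (1 : ℂ) = 1 := by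
  simpa using integral_gaussian_smul_norm_pow 0

lemma integrable_gaussian_smul_one :
    Integrable fun z : ℂ => (Real.pi⁻¹ * Real.exp (-‖z‖ ^ 2) : ℝ) • (1 : ℂ) :=
  integrable_gaussian_smul_of_norm_le (h := fun _ => 1) measurable_const 0 (by simp)

lemma integral_apply_complexGaussian {N : ℕ} (k : Fin N) (h : ℂ → ℂ) :
    ∫ x, h (x k) ∂complexGaussian N =
      ∫ z : ℂ, (Real.pi⁻¹ * Real.exp (-‖z‖ ^ 2) : ℝ) • h z := by
  classical
  have := integral_prod_complexGaussian (N := N) (fun i => if i = k then h else fun _ => 1)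
  rw [Fintype.prod_eq_single k (fun i hi => by simp only [hi, if_false, integral_gaussian_smul_one])]
    at this
  simp only [if_true] at this
  rw [← this]
  refine integral_congr_ae (ae_of_all _ fun x => ?_)
  dsimp only
  rw [Fintype.prod_eq_single k (fun i hi => by simp [hi])]
  simp

/-- Independence of the coordinates factors the integral, and the odd factor vanishes. The
factorization needs no integrability, so `h'` is arbitrary. -/
lemma integral_mul_apply_complexGaussian_of_odd {N : ℕ} {k l : Fin N} (hkl : k ≠ l) {h h' : ℂ → ℂ}
    (ho : ∀ z, h (-z) = -h z) :
    ∫ x, h (x k) * h' (x l) ∂complexGaussian N = 0 := by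
  classical
  have := integral_prod_complexGaussian (N := N)
    (fun i => if i = k then h else if i = l then h' else fun _ => 1)
  rw [Finset.prod_eq_zero (Finset.mem_univ k)
    (by simpa using integral_gaussian_smul_of_odd ho)] at this
  rw [← this]
  refine integral_congr_ae (ae_of_all _ fun x => ?_)
  dsimp only
  rw [Fintype.prod_eq_mul k l hkl (fun i hi => by simp [hi.1, hi.2])]
  simp [hkl.symm]

lemma integrable_apply_complexGaussian {N : ℕ} (k : Fin N) {h : ℂ → ℂ}
    (hh : Integrable fun z : ℂ => (Real.pi⁻¹ * Real.exp (-‖z‖ ^ 2) : ℝ) • h z) :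
    Integrable (fun x => h (x k)) (complexGaussian N) := by
  classical
  refine (integrable_prod_complexGaussian (N := N) (fun i => if i = k then h else fun _ => 1)
    fun i => ?_).congr (ae_of_all _ fun x => ?_)
  · by_cases hi : i = k
    · simpa [hi] using hh
    · simpa [hi] using integrable_gaussian_smul_one
  · dsimp only
    rw [Fintype.prod_eq_single k (fun i hi => by simp [hi])]
    simp

instance isProbabilityMeasure_complexGaussian (N : ℕ) :
    IsProbabilityMeasure (complexGaussian N) := by
  have h1 := integral_prod_complexGaussian (N := N) (fun _ _ => 1)
  rw [Finset.prod_congr rfl fun _ _ => integral_gaussian_smul_one] at h1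
  simp only [Finset.prod_const_one, integral_const, mul_one, Complex.real_smul] at h1
  constructor
  have h2 : (complexGaussian N).real Set.univ = 1 := by exact_mod_cast h1
  rw [Measure.real, ENNReal.toReal_eq_one_iff] at h2
  exact h2

lemma memLp_apply_complexGaussian {N : ℕ} (k : Fin N) :
    MemLp (fun x : Fin N → ℂ => x k) 2 (complexGaussian N) := by
  rw [memLp_two_iff_integrable_sq_norm (measurable_pi_apply k).aestronglyMeasurable]
  have := (integrable_apply_complexGaussian (N := N) k (h := fun z => ((‖z‖ ^ 2 : ℝ) : ℂ))
    (integrable_gaussian_smul_of_norm_le (by fun_prop) 2 (by simp))).re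
  simpa [← Complex.ofReal_pow] using this

/-- Unitary maps preserve the standard complex Gaussian measure. -/
lemma measurePreserving_complexGaussian {N : ℕ}
    (R : EuclideanSpace ℂ (Fin N) ≃ₗᵢ[ℂ] EuclideanSpace ℂ (Fin N)) :
    MeasurePreserving (fun x => (R (WithLp.toLp 2 x)).ofLp) (complexGaussian N)
      (complexGaussian N) := by
  let T : (Fin N → ℂ) ≃L[ℝ] (Fin N → ℂ) :=
    ((EuclideanSpace.equiv (Fin N) ℂ).symm.trans
      (R.toContinuousLinearEquiv.trans (EuclideanSpace.equiv (Fin N) ℂ))).restrictScalars ℝ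
  have hT : (fun x => (R (WithLp.toLp 2 x)).ofLp) = T := rfl
  have hTm : Measurable T := T.continuous.measurable
  have hden : ∀ x, complexGaussianDensity N (T x) = complexGaussianDensity N x := by
    have e : ∀ x, complexGaussianDensity N x =
        Real.pi⁻¹ ^ N * Real.exp (-‖(WithLp.toLp 2 x : EuclideanSpace ℂ (Fin N))‖ ^ 2) := by
      intro x
      rw [complexGaussianDensity, Finset.prod_mul_distrib, ← Real.exp_sum, EuclideanSpace.norm_sq_eq]
      simp
    intro x
    rw [e, e, ← R.norm_map (WithLp.toLp 2 x)]
    rfl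
  -- The factor by which `T` scales Lebesgue measure need not be computed: `T` preserves the
  -- density, so comparing total masses forces `c = 1`.
  obtain ⟨c, hc⟩ : ∃ c : NNReal, Measure.map T volume = c • (volume : Measure (Fin N → ℂ)) :=
    ⟨_, Measure.isAddLeftInvariant_eq_smul _ _⟩
  have hdm : Measurable fun x => ENNReal.ofReal (complexGaussianDensity N x) :=
    (continuous_complexGaussianDensity N).measurable.ennreal_ofReal
  have key : ∀ s, MeasurableSet s →
      complexGaussian N (T ⁻¹' s) = c * complexGaussian N s := by
    intro s hs
    rw [complexGaussian, withDensity_apply _ (hTm hs), withDensity_apply _ hs]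
    have h1 := setLIntegral_map (μ := volume) hs hdm hTm
    rw [hc] at h1
    simp only [hden] at h1
    rw [← h1, Measure.restrict_smul, lintegral_smul_measure]
    rfl
  have hc1 : (c : ℝ≥0∞) = 1 := by
    have := key Set.univ MeasurableSet.univ
    simpa using this.symm
  rw [hT]
  refine ⟨hTm, Measure.ext fun s hs => ?_⟩
  rw [Measure.map_apply hTm hs, key s hs, hc1, one_mul]

/-! ### The Gaussian field, its phase and their covariances. -/

/-- The random linear functional `u ↦ ⟪x, u⟫` on `ℂⁿ`. -/
noncomputable def gaussianField {N : ℕ} (u : EuclideanSpace ℂ (Fin N)) (x : Fin N → ℂ) : ℂ :=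
  inner ℂ (WithLp.toLp 2 x) u

/-- The phase of the Gaussian field, scaled by the norm of the vector. -/
noncomputable def gaussianPhase {N : ℕ} (u : EuclideanSpace ℂ (Fin N)) (x : Fin N → ℂ) : ℂ :=
  ‖u‖ * (gaussianField u x / ‖gaussianField u x‖)

lemma gaussianField_eq_sum {N : ℕ} (u : EuclideanSpace ℂ (Fin N)) (x : Fin N → ℂ) :
    gaussianField u x = ∑ k, u k * conj (x k) := by
  simp [gaussianField, PiLp.inner_apply]

lemma measurable_gaussianField {N : ℕ} (u : EuclideanSpace ℂ (Fin N)) :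
    Measurable (gaussianField u) := by
  have : gaussianField u = fun x => ∑ k, u k * conj (x k) := funext (gaussianField_eq_sum u)
  rw [this]
  exact (by fun_prop : Continuous fun x : Fin N → ℂ => ∑ k, u k * conj (x k)).measurable

lemma measurable_gaussianPhase {N : ℕ} (u : EuclideanSpace ℂ (Fin N)) :
    Measurable (gaussianPhase u) := by
  have := measurable_gaussianField u
  unfold gaussianPhase
  fun_prop

lemma norm_gaussianPhase_le {N : ℕ} (u : EuclideanSpace ℂ (Fin N)) (x : Fin N → ℂ) :
    ‖gaussianPhase u x‖ ≤ ‖u‖ := by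
  rw [gaussianPhase, norm_mul, norm_div, Complex.norm_real, Complex.norm_real, norm_norm, norm_norm]
  exact mul_le_of_le_one_right (norm_nonneg _) (div_self_le_one _)

lemma memLp_gaussianPhase {N : ℕ} (u : EuclideanSpace ℂ (Fin N)) :
    MemLp (gaussianPhase u) 2 (complexGaussian N) :=
  MemLp.of_bound (measurable_gaussianPhase u).aestronglyMeasurable ‖u‖
    (ae_of_all _ (norm_gaussianPhase_le u))

lemma memLp_conj_apply_complexGaussian {N : ℕ} (k : Fin N) :
    MemLp (fun x : Fin N → ℂ => conj (x k)) 2 (complexGaussian N) :=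
  (memLp_apply_complexGaussian k).star

lemma memLp_gaussianField {N : ℕ} (u : EuclideanSpace ℂ (Fin N)) :
    MemLp (gaussianField u) 2 (complexGaussian N) := by
  have : gaussianField u = fun x => ∑ k, u k * conj (x k) := funext (gaussianField_eq_sum u)
  rw [this]
  exact memLp_finsetSum _ fun k _ => (memLp_conj_apply_complexGaussian k).const_mul _

lemma integrable_conj_mul {α : Type*} [MeasurableSpace α] {μ : Measure α} {f g : α → ℂ}
    (hf : MemLp f 2 μ) (hg : MemLp g 2 μ) : Integrable (fun x => conj (f x) * g x) μ :=
  hf.star.integrable_mul hg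

lemma integral_conj_gaussianField_mul {N : ℕ} (u v : EuclideanSpace ℂ (Fin N)) :
    ∫ x, conj (gaussianField u x) * gaussianField v x ∂complexGaussian N = inner ℂ u v := by
  have hi : ∀ k l, Integrable (fun x : Fin N → ℂ => x k * conj (x l)) (complexGaussian N) :=
    fun k l => (memLp_apply_complexGaussian k).integrable_mul (memLp_conj_apply_complexGaussian l)
  have hc : ∀ k l, ∫ x : Fin N → ℂ, x k * conj (x l) ∂complexGaussian N = if k = l then 1 else 0 := by
    intro k l
    split_ifs with h
    · subst h
      have := integral_apply_complexGaussian k fun z => ((‖z‖ ^ 2 : ℝ) : ℂ)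
      rw [integral_gaussian_smul_norm_pow] at this
      simp only [Complex.mul_conj, Complex.normSq_eq_norm_sq]
      rw [this]
      norm_num [Real.Gamma_two]
    · exact integral_mul_apply_complexGaussian_of_odd h (h := fun z => z) (h' := fun z => conj z)
        fun _ => rfl
  have he : ∀ x : Fin N → ℂ, conj (gaussianField u x) * gaussianField v x =
      ∑ k, ∑ l, conj (u k) * v l * (x k * conj (x l)) := by
    intro x
    rw [gaussianField_eq_sum, gaussianField_eq_sum, map_sum, Finset.sum_mul_sum]
    refine Finset.sum_congr rfl fun k _ => Finset.sum_congr rfl fun l _ => ?_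
    simp only [map_mul, Complex.conj_conj]
    ring
  simp only [he]
  rw [integral_finsetSum _ fun k _ => integrable_finsetSum _ fun l _ => (hi k l).const_mul _]
  simp_rw [integral_finsetSum _ fun l _ => (hi _ l).const_mul _, integral_const_mul, hc]
  simp [PiLp.inner_apply, mul_comm]

/-- Only the `i`-th term of the field survives, by oddness; the constant is `E|z| = Γ(3/2) = √π /
2`. -/
lemma integral_conj_gaussianPhase_mul_of_basis {N : ℕ} (i : Fin N) (v : EuclideanSpace ℂ (Fin N)) :
    ∫ x, conj (gaussianPhase (EuclideanSpace.single i 1) x) * gaussianField v x ∂complexGaussian N =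
      (√Real.pi / 2 : ℝ) * v i := by
  have hs : ∀ x : Fin N → ℂ, conj (gaussianPhase (EuclideanSpace.single i 1) x) = x i / ‖x i‖ := by
    intro x
    simp [gaussianPhase, gaussianField_eq_sum]
  have hp : MemLp (fun x : Fin N → ℂ => x i / ‖x i‖) 2 (complexGaussian N) := by
    simp only [← hs]
    exact (memLp_gaussianPhase (EuclideanSpace.single i (1 : ℂ))).star
  have hc : ∀ k, ∫ x : Fin N → ℂ, (x i / ‖x i‖) * conj (x k) ∂complexGaussian N =
      if k = i then ((√Real.pi / 2 : ℝ) : ℂ) else 0 := by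
    intro k
    split_ifs with h
    · subst h
      have := integral_apply_complexGaussian k fun z => ((‖z‖ ^ 1 : ℝ) : ℂ)
      rw [integral_gaussian_smul_norm_pow] at this
      have e : ∀ z : ℂ, z / ‖z‖ * conj z = ((‖z‖ ^ 1 : ℝ) : ℂ) := by
        intro z
        rw [div_mul_eq_mul_div, Complex.mul_conj, Complex.normSq_eq_norm_sq, ← Complex.ofReal_div]
        congr 1
        rw [pow_two, mul_self_div_self, pow_one]
      simp only [e]
      rw [this, Real.Gamma_add_one (by norm_num), Nat.cast_one, Real.Gamma_one_half_eq]
      congr 1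
      ring
    · exact integral_mul_apply_complexGaussian_of_odd (Ne.symm h) (h := fun z => z / ‖z‖)
        (h' := fun z => conj z) fun z => by rw [norm_neg, neg_div]
  simp only [hs, gaussianField_eq_sum, Finset.mul_sum]
  have hi : ∀ k, Integrable (fun x : Fin N → ℂ => (x i / ‖x i‖) * (v k * conj (x k)))
      (complexGaussian N) := fun k =>
    hp.integrable_mul ((memLp_conj_apply_complexGaussian k).const_mul (v k))
  rw [integral_finsetSum _ fun k _ => hi k]
  simp_rw [mul_left_comm _ (v _), integral_const_mul, hc]
  simp [mul_comm]

lemma exists_linearIsometryEquiv_single {N : ℕ} (i : Fin N) {u : EuclideanSpace ℂ (Fin N)}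
    (hu : ‖u‖ = 1) :
    ∃ R : EuclideanSpace ℂ (Fin N) ≃ₗᵢ[ℂ] EuclideanSpace ℂ (Fin N),
      R (EuclideanSpace.single i 1) = u := by
  obtain ⟨b, hb⟩ := Orthonormal.exists_orthonormalBasis_extension_of_card_eq (𝕜 := ℂ)
    (E := EuclideanSpace ℂ (Fin N)) (ι := Fin N) (by simp) (v := fun _ => u) (s := {i})
    ⟨fun _ => hu, fun a c hac => absurd (Subsingleton.elim a c) hac⟩
  exact ⟨b.repr.symm, by rw [b.repr_symm_single, hb i rfl]⟩

lemma gaussianField_map {N : ℕ} (R : EuclideanSpace ℂ (Fin N) ≃ₗᵢ[ℂ] EuclideanSpace ℂ (Fin N))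
    (u : EuclideanSpace ℂ (Fin N)) (x : Fin N → ℂ) :
    gaussianField (R u) (R (WithLp.toLp 2 x)).ofLp = gaussianField u x :=
  R.inner_map_map _ _

lemma gaussianPhase_map {N : ℕ} (R : EuclideanSpace ℂ (Fin N) ≃ₗᵢ[ℂ] EuclideanSpace ℂ (Fin N))
    (u : EuclideanSpace ℂ (Fin N)) (x : Fin N → ℂ) :
    gaussianPhase (R u) (R (WithLp.toLp 2 x)).ofLp = gaussianPhase u x := by
  rw [gaussianPhase, gaussianField_map, R.norm_map, gaussianPhase]

lemma gaussianPhase_smul {N : ℕ} {r : ℝ} (hr : 0 ≤ r) (u : EuclideanSpace ℂ (Fin N))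
    (x : Fin N → ℂ) : gaussianPhase ((r : ℂ) • u) x = r * gaussianPhase u x := by
  rcases hr.eq_or_lt with rfl | hr
  · simp [gaussianPhase]
  · have h : gaussianField ((r : ℂ) • u) x = r * gaussianField u x := by
      rw [gaussianField, inner_smul_right, gaussianField]
    have hr' : (r : ℂ) ≠ 0 := by exact_mod_cast hr.ne'
    rw [gaussianPhase, h, norm_smul, norm_mul, Complex.norm_real, Real.norm_of_nonneg hr.le,
      gaussianPhase, Complex.ofReal_mul, Complex.ofReal_mul, mul_div_mul_left _ _ hr', mul_assoc]

/-- Both sides scale alike in `u`, and unitary invariance moves a unit vector to a basis vector. -/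
lemma integral_conj_gaussianPhase_mul {N : ℕ} (u v : EuclideanSpace ℂ (Fin N)) :
    ∫ x, conj (gaussianPhase u x) * gaussianField v x ∂complexGaussian N =
      (√Real.pi / 2 : ℝ) * inner ℂ u v := by
  rcases eq_or_ne u 0 with rfl | hu
  · simp [gaussianPhase]
  -- Any index will do; `u ≠ 0` only serves to exclude `N = 0`.
  obtain ⟨i, -⟩ : ∃ i, u i ≠ 0 := by
    by_contra! h
    exact hu (by ext i; exact h i)
  have hn : (‖u‖ : ℂ) ≠ 0 := by simpa using hu
  set w := ((‖u‖ : ℂ)⁻¹) • u with hw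
  have huw : u = (‖u‖ : ℂ) • w := by rw [hw, smul_inv_smul₀ hn]
  have hw1 : ‖w‖ = 1 := by
    rw [hw, norm_smul, norm_inv, Complex.norm_real, norm_norm, inv_mul_cancel₀ (by simpa using hu)]
  obtain ⟨R, hR⟩ := exists_linearIsometryEquiv_single i hw1
  have key : ∫ x, conj (gaussianPhase w x) * gaussianField v x ∂complexGaussian N =
      (√Real.pi / 2 : ℝ) * inner ℂ w v := by
    have hm := measurePreserving_complexGaussian R
    have hg : AEStronglyMeasurable (fun x => conj (gaussianPhase w x) * gaussianField v x)
        (complexGaussian N) :=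
      (integrable_conj_mul (memLp_gaussianPhase w) (memLp_gaussianField v)).aestronglyMeasurable
    have h1 := integral_map hm.measurable.aemeasurable (hm.map_eq.symm ▸ hg)
    rw [hm.map_eq] at h1
    rw [h1, ← hR, ← R.apply_symm_apply v]
    simp only [gaussianPhase_map, gaussianField_map, R.inner_map_map]
    rw [integral_conj_gaussianPhase_mul_of_basis, EuclideanSpace.inner_single_left]
    simp
  have hph : ∀ x, gaussianPhase u x = ‖u‖ * gaussianPhase w x := fun x => by
    conv_lhs => rw [huw]
    exact gaussianPhase_smul (norm_nonneg u) w x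
  simp only [hph, map_mul, Complex.conj_ofReal, mul_assoc, integral_const_mul]
  rw [key]
  conv_rhs => rw [huw, inner_smul_left, Complex.conj_ofReal]
  ring

/-- The part of the Gaussian phase orthogonal to the Gaussian field. -/
noncomputable def phaseResidual {N : ℕ} (u : EuclideanSpace ℂ (Fin N)) :
    Lp ℂ 2 (complexGaussian N) :=
  ((memLp_gaussianPhase u).sub
    ((memLp_gaussianField u).const_mul ((√Real.pi / 2 : ℝ) : ℂ))).toLp

/-- With `c = √π / 2`, the two cross terms give `-2c²⟪u, v⟫` and the field term `+c²⟪u, v⟫`, leaving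
`-c² = -π / 4`. -/
lemma inner_phaseResidual {N : ℕ} (u v : EuclideanSpace ℂ (Fin N)) :
    inner ℂ (phaseResidual u) (phaseResidual v) =
      ∫ x, conj (gaussianPhase u x) * gaussianPhase v x ∂complexGaussian N -
        (Real.pi / 4 : ℝ) * inner ℂ u v := by
  have hss := integrable_conj_mul (memLp_gaussianPhase u) (memLp_gaussianPhase v)
  have hsf := integrable_conj_mul (memLp_gaussianPhase u) (memLp_gaussianField v)
  have hfs := integrable_conj_mul (memLp_gaussianField u) (memLp_gaussianPhase v)
  have hff := integrable_conj_mul (memLp_gaussianField u) (memLp_gaussianField v)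
  set c : ℝ := √Real.pi / 2 with hc
  have hcc : c * c = Real.pi / 4 := by
    rw [hc, div_mul_div_comm, Real.mul_self_sqrt Real.pi_pos.le]
    norm_num
  have hfs' : ∫ x, conj (gaussianField u x) * gaussianPhase v x ∂complexGaussian N =
      c * inner ℂ u v := by
    have := congrArg conj (integral_conj_gaussianPhase_mul v u)
    rw [← integral_conj, map_mul, Complex.conj_ofReal, inner_conj_symm] at this
    rw [← this]
    simp [mul_comm]
  have e : ∀ᵐ x ∂complexGaussian N, inner ℂ (phaseResidual u x) (phaseResidual v x) =
      conj (gaussianPhase u x) * gaussianPhase v x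
        - c * (conj (gaussianPhase u x) * gaussianField v x)
        - c * (conj (gaussianField u x) * gaussianPhase v x)
        + (c * c) * (conj (gaussianField u x) * gaussianField v x) := by
    filter_upwards [MemLp.coeFn_toLp ((memLp_gaussianPhase u).sub
        ((memLp_gaussianField u).const_mul ((√Real.pi / 2 : ℝ) : ℂ))),
      MemLp.coeFn_toLp ((memLp_gaussianPhase v).sub
        ((memLp_gaussianField v).const_mul ((√Real.pi / 2 : ℝ) : ℂ)))] with x hx hy
    rw [phaseResidual, phaseResidual, hx, hy, ← hc]
    simp only [Pi.sub_apply, RCLike.inner_apply, map_sub, map_mul, Complex.conj_ofReal]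
    ring
  rw [L2.inner_def, integral_congr_ae e,
    integral_add (by exact (hss.sub (hsf.const_mul _)).sub (hfs.const_mul _)) (hff.const_mul _),
    integral_sub (by exact hss.sub (hsf.const_mul _)) (hfs.const_mul _),
    integral_sub hss (hsf.const_mul _)]
  simp only [integral_const_mul]
  rw [hfs', integral_conj_gaussianPhase_mul, integral_conj_gaussianField_mul, ← hc, ← hcc]
  push_cast
  ring

lemma norm_phaseResidual_le {N : ℕ} {u : EuclideanSpace ℂ (Fin N)} (hu : ‖u‖ ≤ 1) :
    ‖phaseResidual u‖ ≤ √(1 - Real.pi / 4) := by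
  apply Real.le_sqrt_of_sq_le
  have h1 : ‖phaseResidual u‖ ^ 2 =
      ∫ x, ‖gaussianPhase u x‖ ^ 2 ∂complexGaussian N - Real.pi / 4 * ‖u‖ ^ 2 := by
    have h := congrArg Complex.re (inner_phaseResidual u u)
    simp only [Complex.conj_mul', ← Complex.ofReal_pow] at h
    rw [integral_complex_ofReal, Complex.sub_re, Complex.re_ofReal_mul, Complex.ofReal_re] at h
    exact (inner_self_eq_norm_sq (𝕜 := ℂ) u) ▸ (inner_self_eq_norm_sq (𝕜 := ℂ) (phaseResidual u)) ▸ h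
  have h2 : ∫ x, ‖gaussianPhase u x‖ ^ 2 ∂complexGaussian N ≤ ‖u‖ ^ 2 := by
    have h := integral_mono (μ := complexGaussian N)
      ((memLp_two_iff_integrable_sq_norm (measurable_gaussianPhase u).aestronglyMeasurable).1
        (memLp_gaussianPhase u)) (integrable_const (‖u‖ ^ 2))
      fun x => pow_le_pow_left₀ (norm_nonneg _) (norm_gaussianPhase_le u x) 2
    simpa using h
  have h3 : 0 ≤ 1 - Real.pi / 4 := by linarith [Real.pi_le_four]
  have h4 : ‖u‖ ^ 2 ≤ 1 := pow_le_one₀ (norm_nonneg _) hu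
  rw [h1]
  nlinarith

/-! ### Grothendieck's inequalities for Hilbert space vectors. -/

/-- The value `∑ i, ∑ j, X i j * ⟪u i, v j⟫` of the kernel `X` on two families of vectors. -/
noncomputable def hilbertForm {m n : ℕ} {H : Type*} [SeminormedAddCommGroup H]
    [InnerProductSpace ℂ H] (X : Matrix (Fin m) (Fin n) ℂ) (u : Fin m → H) (v : Fin n → H) : ℂ :=
  ∑ i, ∑ j, X i j * inner ℂ (u i) (v j)

/-- `C` bounds the kernel `X` on families of vectors in the unit balls of all finite-dimensional
Hilbert spaces. -/
def IsHilbertFormBound {m n : ℕ} (X : Matrix (Fin m) (Fin n) ℂ) (C : ℝ) : Prop :=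
  ∀ (N : ℕ) (u : Fin m → EuclideanSpace ℂ (Fin N)) (v : Fin n → EuclideanSpace ℂ (Fin N)),
    (∀ i, ‖u i‖ ≤ 1) → (∀ j, ‖v j‖ ≤ 1) → ‖hilbertForm X u v‖ ≤ C

section

variable {m n : ℕ} {H : Type*} [NormedAddCommGroup H] [InnerProductSpace ℂ H]

lemma hilbertForm_smul_smul (X : Matrix (Fin m) (Fin n) ℂ) (u : Fin m → H) (v : Fin n → H)
    (a b : ℂ) : hilbertForm X (fun i => a • u i) (fun j => b • v j) =
      conj a * b * hilbertForm X u v := by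
  simp only [hilbertForm, Finset.mul_sum, inner_smul_left, inner_smul_right]
  refine Finset.sum_congr rfl fun i _ => Finset.sum_congr rfl fun j _ => ?_
  ring

/-- The form sees only the span of the finitely many vectors. This allows the bound to be applied to
the residuals, which live in `L²`. -/
lemma IsHilbertFormBound.norm_hilbertForm_le {X : Matrix (Fin m) (Fin n) ℂ} {C : ℝ}
    (hC : IsHilbertFormBound X C) {u : Fin m → H} {v : Fin n → H}
    (hu : ∀ i, ‖u i‖ ≤ 1) (hv : ∀ j, ‖v j‖ ≤ 1) : ‖hilbertForm X u v‖ ≤ C := by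
  let S : Submodule ℂ H := Submodule.span ℂ (Set.range u ∪ Set.range v)
  have hS : FiniteDimensional ℂ S :=
    FiniteDimensional.span_of_finite ℂ ((Set.finite_range u).union (Set.finite_range v))
  let e := (stdOrthonormalBasis ℂ S).repr
  let u' : Fin m → S := fun i => ⟨u i, Submodule.subset_span (Or.inl ⟨i, rfl⟩)⟩
  let v' : Fin n → S := fun j => ⟨v j, Submodule.subset_span (Or.inr ⟨j, rfl⟩)⟩
  have h := hC _ (fun i => e (u' i)) (fun j => e (v' j)) (fun i => by rw [e.norm_map]; exact hu i)
    (fun j => by rw [e.norm_map]; exact hv j)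
  simp only [hilbertForm, e.inner_map_map] at h
  exact h

lemma IsHilbertFormBound.norm_hilbertForm_le_mul {X : Matrix (Fin m) (Fin n) ℂ} {C : ℝ}
    (hC : IsHilbertFormBound X C) {u : Fin m → H} {v : Fin n → H} {r s : ℝ}
    (hu : ∀ i, ‖u i‖ ≤ r) (hv : ∀ j, ‖v j‖ ≤ s) (hr : 0 ≤ r) (hs : 0 ≤ s) :
    ‖hilbertForm X u v‖ ≤ C * (r * s) := by
  have hunit : ∀ {ι : Type} {w : ι → H} {t : ℝ}, 0 ≤ t → (∀ i, ‖w i‖ ≤ t) →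
      ∃ w' : ι → H, (∀ i, ‖w' i‖ ≤ 1) ∧ w = fun i => (t : ℂ) • w' i := by
    intro ι w t ht hw
    rcases ht.eq_or_lt with rfl | ht
    · exact ⟨0, by simp, funext fun i => by simpa using hw i⟩
    · refine ⟨fun i => (t : ℂ)⁻¹ • w i, fun i => ?_, funext fun i => ?_⟩
      · rw [norm_smul, norm_inv, Complex.norm_real, Real.norm_of_nonneg ht.le, inv_mul_le_one₀ ht]
        exact hw i
      · rw [smul_inv_smul₀ (by exact_mod_cast ht.ne')]
  obtain ⟨u', hu', rfl⟩ := hunit hr hu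
  obtain ⟨v', hv', rfl⟩ := hunit hs hv
  rw [hilbertForm_smul_smul, norm_mul, norm_mul, Complex.conj_ofReal, Complex.norm_real,
    Complex.norm_real, Real.norm_of_nonneg hr, Real.norm_of_nonneg hs, mul_comm]
  exact mul_le_mul_of_nonneg_right (hC.norm_hilbertForm_le hu' hv') (by positivity)

lemma norm_sum_le_normB (X : Matrix (Fin m) (Fin n) ℂ) {a : Fin m → ℂ} {b : Fin n → ℂ}
    (ha : ∀ i, ‖a i‖ ≤ 1) (hb : ∀ j, ‖b j‖ ≤ 1) :
    ‖∑ i, ∑ j, X i j * (a i * b j)‖ ≤ normB X := by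
  have h := (matrixForm X).le_opNorm₂ a b
  rw [matrixForm_apply] at h
  have ha' : ‖a‖ ≤ 1 := (pi_norm_le_iff_of_nonneg zero_le_one).2 ha
  have hb' : ‖b‖ ≤ 1 := (pi_norm_le_iff_of_nonneg zero_le_one).2 hb
  calc _ = ‖∑ i, ∑ j, a i * X i j * b j‖ := by
        congr 1
        exact Finset.sum_congr rfl fun i _ => Finset.sum_congr rfl fun j _ => by ring
    _ ≤ ‖matrixForm X‖ * ‖a‖ * ‖b‖ := h
    _ ≤ ‖matrixForm X‖ * 1 * 1 := by gcongr
    _ = normB X := by rw [mul_one, mul_one, normB]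

lemma normB_nonneg (X : Matrix (Fin m) (Fin n) ℂ) : 0 ≤ normB X :=
  norm_nonneg (matrixForm X)

lemma norm_sum_integral_gaussianPhase_le (X : Matrix (Fin m) (Fin n) ℂ) {N : ℕ}
    {u : Fin m → EuclideanSpace ℂ (Fin N)} {v : Fin n → EuclideanSpace ℂ (Fin N)}
    (hu : ∀ i, ‖u i‖ ≤ 1) (hv : ∀ j, ‖v j‖ ≤ 1) :
    ‖∑ i, ∑ j, X i j *
      ∫ x, conj (gaussianPhase (u i) x) * gaussianPhase (v j) x ∂complexGaussian N‖ ≤ normB X := by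
  have hi : ∀ i j, Integrable
      (fun x => X i j * (conj (gaussianPhase (u i) x) * gaussianPhase (v j) x))
      (complexGaussian N) := fun i j =>
    (integrable_conj_mul (memLp_gaussianPhase _) (memLp_gaussianPhase _)).const_mul _
  simp only [← integral_const_mul]
  simp_rw [← integral_finsetSum _ fun j _ => hi _ j]
  rw [← integral_finsetSum _ fun i _ => integrable_finsetSum _ fun j _ => hi i j]
  have := norm_integral_le_of_norm_le_const (μ := complexGaussian N) (C := normB X)
    (ae_of_all _ fun x => norm_sum_le_normB X (a := fun i => conj (gaussianPhase (u i) x))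
      (b := fun j => gaussianPhase (v j) x)
      (fun i => by rw [RCLike.norm_conj]; exact (norm_gaussianPhase_le _ _).trans (hu i))
      (fun j => (norm_gaussianPhase_le _ _).trans (hv j)))
  simpa using this

lemma hilbertForm_phaseResidual (X : Matrix (Fin m) (Fin n) ℂ) {N : ℕ}
    (u : Fin m → EuclideanSpace ℂ (Fin N)) (v : Fin n → EuclideanSpace ℂ (Fin N)) :
    hilbertForm X (fun i => phaseResidual (u i)) (fun j => phaseResidual (v j)) =
      ∑ i, ∑ j, X i j *
        ∫ x, conj (gaussianPhase (u i) x) * gaussianPhase (v j) x ∂complexGaussian N -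
      (Real.pi / 4 : ℝ) * hilbertForm X u v := by
  simp only [hilbertForm, inner_phaseResidual, Finset.mul_sum, ← Finset.sum_sub_distrib]
  refine Finset.sum_congr rfl fun i _ => Finset.sum_congr rfl fun j _ => ?_
  ring

lemma exists_isLeast_hilbertFormBound (X : Matrix (Fin m) (Fin n) ℂ) :
    ∃ C, IsLeast {C | IsHilbertFormBound X C} C := by
  have hne : {C | IsHilbertFormBound X C}.Nonempty := by
    refine ⟨∑ i, ∑ j, ‖X i j‖, fun N u v hu hv => ?_⟩
    refine norm_sum_le_of_le _ fun i _ => norm_sum_le_of_le _ fun j _ => ?_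
    rw [norm_mul]
    refine mul_le_of_le_one_right (norm_nonneg _) ((norm_inner_le_norm _ _).trans ?_)
    exact mul_le_one₀ (hu i) (norm_nonneg _) (hv j)
  have hbd : BddBelow {C | IsHilbertFormBound X C} :=
    ⟨0, fun C hC => (norm_nonneg _).trans (hC 0 0 0 (by simp) (by simp))⟩
  exact ⟨_, fun N u v hu hv => le_csInf hne fun C hC => hC N u v hu hv, fun C hC => csInf_le hbd hC⟩

/-- Grothendieck's inequality in the Hilbert space formulation. -/
theorem isHilbertFormBound_of_normB (X : Matrix (Fin m) (Fin n) ℂ) :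
    IsHilbertFormBound X ((4 / Real.pi) / (2 - 4 / Real.pi) * normB X) := by
  obtain ⟨C, hC, hmin⟩ := exists_isLeast_hilbertFormBound X
  have hpi := Real.pi_pos
  have hpi3 := Real.pi_gt_three
  have h1 : 0 ≤ 1 - Real.pi / 4 := by linarith [Real.pi_le_four]
  -- Self-improvement: applying the bound `C` to the residuals yields a new bound, which minimality
  -- of `C` compares with `C` itself.
  have hstep : IsHilbertFormBound X (4 / Real.pi * (normB X + C * (1 - Real.pi / 4))) := by
    intro N u v hu hv
    have hres := hC.norm_hilbertForm_le_mul
      (fun i => norm_phaseResidual_le (hu i)) (fun j => norm_phaseResidual_le (hv j))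
      (Real.sqrt_nonneg _) (Real.sqrt_nonneg _)
    rw [Real.mul_self_sqrt h1, hilbertForm_phaseResidual] at hres
    have hph := norm_sum_integral_gaussianPhase_le X hu hv
    have h2 := norm_le_norm_add_norm_sub' ((Real.pi / 4 : ℝ) * hilbertForm X u v)
      (∑ i, ∑ j, X i j *
        ∫ x, conj (gaussianPhase (u i) x) * gaussianPhase (v j) x ∂complexGaussian N)
    rw [norm_sub_rev, norm_mul, Complex.norm_real, Real.norm_of_nonneg (by positivity)] at h2
    rw [div_mul_eq_mul_div, le_div_iff₀ hpi]
    linarith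
  have h3 := hmin hstep
  have hden : 0 < 2 - 4 / Real.pi := by
    rw [sub_pos, div_lt_iff₀ hpi]
    linarith
  have hCle : C ≤ (4 / Real.pi) / (2 - 4 / Real.pi) * normB X := by
    rw [div_mul_eq_mul_div, le_div_iff₀ hden]
    have : 4 / Real.pi * (normB X + C * (1 - Real.pi / 4)) =
        4 / Real.pi * normB X + C * (4 / Real.pi) - C := by
      field_simp
      ring
    linarith
  exact fun N u v hu hv => (hC N u v hu hv).trans hCle

/-- Writing `X = B* B` turns the form into `∑ k, ‖∑ i, B k i • u i‖²`. -/
lemma re_hilbertForm_self_nonneg {X : Matrix (Fin n) (Fin n) ℂ} (hX : X.PosSemidef)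
    (u : Fin n → H) : 0 ≤ (hilbertForm X u u).re := by
  open scoped MatrixOrder in
  obtain ⟨B, rfl⟩ := (CStarAlgebra.nonneg_iff_eq_star_mul_self (a := X)).mp hX.nonneg
  have h : hilbertForm (star B * B) u u =
      ∑ k, inner ℂ (∑ i, B k i • u i) (∑ j, B k j • u j) := by
    have hk : ∀ k, inner ℂ (∑ i, B k i • u i) (∑ j, B k j • u j) =
        ∑ i, ∑ j, star (B k i) * B k j * inner ℂ (u i) (u j) := by
      intro k
      rw [sum_inner]
      refine Finset.sum_congr rfl fun i _ => ?_
      rw [inner_sum]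
      refine Finset.sum_congr rfl fun j _ => ?_
      rw [inner_smul_left, inner_smul_right, mul_assoc]
      rfl
    simp only [hilbertForm, hk, Matrix.mul_apply, Matrix.star_apply, Finset.sum_mul]
    rw [Finset.sum_comm (f := fun k i => ∑ j, star (B k i) * B k j * inner ℂ (u i) (u j))]
    exact Finset.sum_congr rfl fun i _ => Finset.sum_comm
  rw [h, Complex.re_sum]
  exact Finset.sum_nonneg fun k _ => inner_self_nonneg (𝕜 := ℂ)

lemma hilbertForm_sub_self (X : Matrix (Fin n) (Fin n) ℂ) (u v : Fin n → H) :
    hilbertForm X (u - v) (u - v) =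
      hilbertForm X u u - hilbertForm X u v - hilbertForm X v u + hilbertForm X v v := by
  simp only [hilbertForm, ← Finset.sum_sub_distrib, ← Finset.sum_add_distrib, Pi.sub_apply,
    inner_sub_left, inner_sub_right]
  refine Finset.sum_congr rfl fun i _ => Finset.sum_congr rfl fun j _ => ?_
  ring

lemma conj_hilbertForm {X : Matrix (Fin n) (Fin n) ℂ} (hX : X.IsHermitian) (u v : Fin n → H) :
    conj (hilbertForm X u v) = hilbertForm X v u := by
  simp only [hilbertForm, map_sum, map_mul, inner_conj_symm]
  rw [Finset.sum_comm]
  refine Finset.sum_congr rfl fun i _ => Finset.sum_congr rfl fun j _ => ?_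
  rw [← hX.apply i j]
  rfl

/-- Grothendieck's little inequality for a positive kernel in the Hilbert space formulation. -/
theorem isHilbertFormBound_of_posSemidef {X : Matrix (Fin n) (Fin n) ℂ} (hX : X.PosSemidef) :
    IsHilbertFormBound X (4 / Real.pi * normB X) := by
  intro N u v hu hv
  have hdiag : ∀ w : Fin n → EuclideanSpace ℂ (Fin N), (∀ i, ‖w i‖ ≤ 1) →
      (hilbertForm X w w).re ≤ 4 / Real.pi * normB X := by
    intro w hw
    have h1 := re_hilbertForm_self_nonneg hX fun i => phaseResidual (w i)
    rw [hilbertForm_phaseResidual, Complex.sub_re, Complex.re_ofReal_mul] at h1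
    have h2 := (Complex.re_le_norm _).trans (norm_sum_integral_gaussianPhase_le X hw hw)
    rw [div_mul_eq_mul_div, le_div_iff₀ Real.pi_pos]
    linarith
  -- Rotating `v` by the phase `c` makes the form real; positivity at `u - c • v` then gives twice
  -- its modulus at most the sum of the two diagonal values.
  obtain ⟨c, hc, hcn⟩ : ∃ c : ℂ, ‖c‖ = 1 ∧ c * hilbertForm X u v = ‖hilbertForm X u v‖ := by
    exact RCLike.exists_norm_eq_mul_self (hilbertForm X u v) |>.imp fun c h => ⟨h.1, h.2.symm⟩
  have hform : hilbertForm X u (fun j => c • v j) = ‖hilbertForm X u v‖ := by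
    have := hilbertForm_smul_smul X u v 1 c
    simpa [hcn] using this
  have hv' : ∀ j, ‖c • v j‖ ≤ 1 := fun j => by rw [norm_smul, hc, one_mul]; exact hv j
  have h := re_hilbertForm_self_nonneg hX (u - fun j => c • v j)
  rw [hilbertForm_sub_self, ← conj_hilbertForm hX.1 u (fun j => c • v j), hform, Complex.conj_ofReal, Complex.add_re,
    Complex.sub_re, Complex.sub_re, Complex.ofReal_re] at h
  linarith [hdiag u hu, hdiag _ hv']

end

/-! ### From Hilbert space vectors to the completely bounded norm. -/

/-- Complex matrices with their C*-norm, acting on Euclidean space. -/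
noncomputable def CStarMatrix.toEuclideanStarAlgEquiv (k : ℕ) :
    CStarMatrix (Fin k) (Fin k) ℂ ≃⋆ₐ[ℂ]
      (EuclideanSpace ℂ (Fin k) →L[ℂ] EuclideanSpace ℂ (Fin k)) :=
  CStarMatrix.ofMatrixStarAlgEquiv.symm.trans Matrix.toEuclideanCLM

/-- The matrix of `i`-th coordinates of a matrix over `ℂᵐ`. -/
noncomputable def CStarMatrix.evalStarAlgHom (k : ℕ) {m : ℕ} (i : Fin m) :
    CStarMatrix (Fin k) (Fin k) (Fin m → ℂ) →⋆ₙₐ[ℂ] CStarMatrix (Fin k) (Fin k) ℂ :=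
  CStarMatrix.mapₙₐ (Pi.evalNonUnitalStarAlgHom ℂ (fun _ : Fin m => ℂ) i)

lemma amplification_matrixForm {m n : ℕ} (X : Matrix (Fin m) (Fin n) ℂ) (k : ℕ)
    (a : CStarMatrix (Fin k) (Fin k) (Fin m → ℂ)) (b : CStarMatrix (Fin k) (Fin k) (Fin n → ℂ)) :
    amplification (matrixForm X) k a b =
      ∑ i, ∑ j, X i j • (CStarMatrix.evalStarAlgHom k i a * CStarMatrix.evalStarAlgHom k j b) := by
  have happ : ∀ (s : Finset (Fin m × Fin n)) (f : Fin m × Fin n → CStarMatrix (Fin k) (Fin k) ℂ)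
      (p q : Fin k), (∑ x ∈ s, f x) p q = ∑ x ∈ s, f x p q := fun s f p q =>
    Matrix.sum_apply p q s f
  ext p q
  rw [← Fintype.sum_prod_type', happ, Fintype.sum_prod_type]
  simp only [amplification, CStarMatrix.ofMatrix_apply, Matrix.of_apply, matrixForm_apply,
    CStarMatrix.smul_apply, CStarMatrix.mul_apply, smul_eq_mul, Finset.mul_sum]
  rw [Finset.sum_comm]
  refine Finset.sum_congr rfl fun i _ => ?_
  rw [Finset.sum_comm]
  refine Finset.sum_congr rfl fun j _ => Finset.sum_congr rfl fun r _ => ?_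
  change a p r i * X i j * b r q j = X i j * (a p r i * b r q j)
  ring

lemma norm_amplification_le {m n : ℕ} {X : Matrix (Fin m) (Fin n) ℂ} {C : ℝ} (hC0 : 0 ≤ C)
    (hC : IsHilbertFormBound X C) {k : ℕ}
    {a : CStarMatrix (Fin k) (Fin k) (Fin m → ℂ)} {b : CStarMatrix (Fin k) (Fin k) (Fin n → ℂ)}
    (ha : ‖a‖ ≤ 1) (hb : ‖b‖ ≤ 1) : ‖amplification (matrixForm X) k a b‖ ≤ C := by
  let T := CStarMatrix.toEuclideanStarAlgEquiv k
  let A i := T (CStarMatrix.evalStarAlgHom k i a)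
  let B j := T (CStarMatrix.evalStarAlgHom k j b)
  have hA : ∀ i, ‖A i‖ ≤ 1 := fun i =>
    (StarAlgEquiv.norm_map T _).le.trans ((NonUnitalStarAlgHom.norm_apply_le _ _).trans ha)
  have hB : ∀ j, ‖B j‖ ≤ 1 := fun j =>
    (StarAlgEquiv.norm_map T _).le.trans ((NonUnitalStarAlgHom.norm_apply_le _ _).trans hb)
  rw [← StarAlgEquiv.norm_map T, amplification_matrixForm]
  refine ContinuousLinearMap.opNorm_le_of_re_inner_le (𝕜 := ℂ) hC0 fun x y hx hy => ?_
  have hform : inner ℂ y (T (∑ i, ∑ j, X i j •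
      (CStarMatrix.evalStarAlgHom k i a * CStarMatrix.evalStarAlgHom k j b)) x) =
      hilbertForm X (fun i => (A i).adjoint y) (fun j => B j x) := by
    simp only [map_sum, map_smul, map_mul, _root_.sum_apply,
      _root_.smul_apply, inner_sum, inner_smul_right, hilbertForm,
      ContinuousLinearMap.adjoint_inner_left]
    rfl
  rw [inner_re_symm, hform]
  refine (RCLike.re_le_norm _).trans (hC _ _ _ (fun i => ?_) fun j => ?_)
  · calc _ ≤ ‖(A i).adjoint‖ * ‖y‖ := ContinuousLinearMap.le_opNorm _ _
      _ ≤ 1 := by rw [hy, mul_one, LinearIsometryEquiv.norm_map]; exact hA i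
  · calc _ ≤ ‖B j‖ * ‖x‖ := ContinuousLinearMap.le_opNorm _ _
      _ ≤ 1 := by rw [hx, mul_one]; exact hB j

lemma normCbB_le_of_isHilbertFormBound {m n : ℕ} {X : Matrix (Fin m) (Fin n) ℂ} {C : ℝ}
    (hC0 : 0 ≤ C) (hC : IsHilbertFormBound X C) : normCbB X ≤ ENNReal.ofReal C :=
  iSup_le fun _ => iSup_le fun _ => iSup_le fun _ => iSup_le fun ha => iSup_le fun hb =>
    ENNReal.ofReal_le_ofReal (norm_amplification_le hC0 hC ha hb)

/-! ### The least constant. -/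

lemma normB_one_le : normB (1 : Matrix (Fin 1) (Fin 1) ℂ) ≤ 1 := by
  refine ContinuousLinearMap.opNorm_le_bound₂ _ zero_le_one fun a b => ?_
  rw [matrixForm_apply, one_mul]
  simpa using mul_le_mul (norm_le_pi_norm a 0) (norm_le_pi_norm b 0) (norm_nonneg _) (norm_nonneg _)

lemma one_le_normCbB_one : 1 ≤ normCbB (1 : Matrix (Fin 1) (Fin 1) ℂ) := by
  have h1 : amplification (matrixForm (1 : Matrix (Fin 1) (Fin 1) ℂ)) 1 1 1 = 1 := by
    ext p q
    rw [Subsingleton.elim p 0, Subsingleton.elim q 0]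
    simp [amplification, matrixForm_apply]
  rw [normCbB, cbNorm]
  refine le_iSup_of_le 1 (le_iSup_of_le 1 (le_iSup_of_le 1 (le_iSup_of_le CStarRing.norm_one.le
    (le_iSup_of_le CStarRing.norm_one.le ?_))))
  rw [h1, CStarRing.norm_one, ENNReal.ofReal_one]

lemma one_le_of_mem_bigGrothendieckBounds {K : ℝ} (hK : K ∈ bigGrothendieckBounds) : 1 ≤ K := by
  have h := one_le_normCbB_one.trans (hK.2 1 1 1)
  rw [← ENNReal.ofReal_one, ENNReal.ofReal_le_ofReal_iff
    (mul_nonneg hK.1.le (normB_nonneg _))] at h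
  exact h.trans (mul_le_of_le_one_right hK.1.le normB_one_le)

/-- For fixed `X` the admissible `K` form a closed condition, so the infimum satisfies it.
Positivity is not closed; it comes from the lower bound `1` given by the `1 × 1` identity. -/
lemma isLeast_complexGrothendieckConst (hne : bigGrothendieckBounds.Nonempty) :
    IsLeast bigGrothendieckBounds complexGrothendieckConst := by
  have hbd : BddBelow bigGrothendieckBounds :=
    ⟨1, fun K hK => one_le_of_mem_bigGrothendieckBounds hK⟩
  have hone : 1 ≤ complexGrothendieckConst :=
    le_csInf hne fun K hK => one_le_of_mem_bigGrothendieckBounds hK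
  refine ⟨⟨by linarith, fun m n X => ?_⟩, fun K hK => csInf_le hbd hK⟩
  obtain ⟨K₀, hK₀⟩ := hne
  have hfin : normCbB X ≠ ∞ := ne_top_of_le_ne_top ENNReal.ofReal_ne_top (hK₀.2 m n X)
  have hX := normB_nonneg X
  rw [ENNReal.le_ofReal_iff_toReal_le hfin (by positivity)]
  have hle : ∀ K ∈ bigGrothendieckBounds, (normCbB X).toReal ≤ K * normB X := fun K hK =>
    ENNReal.toReal_le_of_le_ofReal (mul_nonneg hK.1.le hX) (hK.2 m n X)
  rcases hX.eq_or_lt with h0 | h0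
  · simpa [← h0] using hle K₀ hK₀
  · rw [← div_le_iff₀ h0]
    exact le_csInf ⟨K₀, hK₀⟩ fun K hK => (div_le_iff₀ h0).2 (hle K hK)

theorem proposition3p1 :
    (∀ (n : ℕ) (X : Matrix (Fin n) (Fin n) ℂ), X.PosSemidef →
      normCbB X ≤ ENNReal.ofReal (4 / Real.pi * normB X)) ∧
    (∀ (m n : ℕ) (X : Matrix (Fin m) (Fin n) ℂ),
      normCbB X ≤ ENNReal.ofReal ((4 / Real.pi) / (2 - 4 / Real.pi) * normB X)) ∧
    IsLeast bigGrothendieckBounds complexGrothendieckConst ∧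
    complexGrothendieckConst ≤ (4 / Real.pi) / (2 - 4 / Real.pi) ∧
    (4 / Real.pi) / (2 - 4 / Real.pi) < 1.752 := by
  have hpi := Real.pi_pos
  have hden : 0 < 2 - 4 / Real.pi := by
    rw [sub_pos, div_lt_iff₀ hpi]
    linarith [Real.pi_gt_three]
  have hpos : 0 < (4 / Real.pi) / (2 - 4 / Real.pi) := by positivity
  have hbig : ∀ (m n : ℕ) (X : Matrix (Fin m) (Fin n) ℂ),
      normCbB X ≤ ENNReal.ofReal ((4 / Real.pi) / (2 - 4 / Real.pi) * normB X) := fun m n X =>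
    normCbB_le_of_isHilbertFormBound (mul_nonneg hpos.le (normB_nonneg X))
      (isHilbertFormBound_of_normB X)
  have hmem : (4 / Real.pi) / (2 - 4 / Real.pi) ∈ bigGrothendieckBounds := ⟨hpos, hbig⟩
  have hleast := isLeast_complexGrothendieckConst ⟨_, hmem⟩
  refine ⟨fun n X hX => normCbB_le_of_isHilbertFormBound
    (mul_nonneg (by positivity) (normB_nonneg X)) (isHilbertFormBound_of_posSemidef hX),
    hbig, hleast, hleast.2 hmem, ?_⟩
  -- The claim amounts to `4 / π < 3.504 / 2.752 ≈ 1.273256`, so sharp that the lower bound `3.1415`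
  -- for `π` would not suffice.
  have h4 : 4 / Real.pi < 4 / 3.141592 :=
    div_lt_div_of_pos_left (by norm_num) (by norm_num) Real.pi_gt_d6
  rw [div_lt_iff₀ hden]
  norm_num at h4 ⊢
  linarith
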